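/- Let $\Sigma$ be a finite alphabet, and let copy-first-half $:\Sigma^*\to\Sigma^*$ be the transduction that maps every string $w=a_0\cdots a_{n-1}$ to its first half $a_0\cdots a_{\lfloor n/2\rfloor-1}$. Then copy-first-half is computed by a B-RASP[pos] program with packed outputs; and if $|\Sigma|>1$, it is neither regular nor polyregular. Here a total function $f:\Sigma^*\to\Gamma^*$ is called - *regular* if it is defined by a deterministic finite-state two-way transducer, which reads $w$ between two end markers, starts on the left end marker, and in each step, depending on its state and the symbol under its head, writes a string and either halts or changes its state and moves its head by at most one cell; - *polyregular* if, for some $k$, it is defined by a deterministic finite-state pebble transducer with at most $k$ pebbles, that is, a two-way transducer with in addition a stack of at most $k$ positions: it can push its head position on the stack and jump to the beginning of the tape, and pop the top position and jump to it; its steps depend on the state, on the symbols at the head and at all pebbles, and on the comparisons ($<,=,>$) between all these positions. A *B-RASP[pos] program* over a finite symbol alphabet $\Delta$ is a finite sequence of definitions of vectors of length $n=|w|$, with Boolean values, values in $\Delta$, or integer values in $\{0,\dots,n-1\}$. Given are the vectors $\mathit{in}(i)=a_i$ and $\mathit{pos}(i)=i$. Each definition is either position-wise, $P(i)=e(i)$,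 or an attention operation: $P(i)=V(j_i)$, where $j_i$ is the leftmost (or the rightmost, as the definition says) $j$ with $M(i,j)$ and $S(i,j)$, and $P(i)=D(i)$ if there is no such $j$. Here $M(i,j)$ is one of $\top$, $j<i$, $j\le i$, $j>i$, $j\ge i$, and $S(i,j)$ is a Boolean expression in $i,j$ or a test $V_1(i)=V_2(j)$ of two integer vectors. Expressions are built from earlier vectors: Boolean ones with $\top,\bot$, equality of symbols, Boolean connectives, and comparisons ($=,<,\le,>,\ge$) of integer expressions that together contain at most one position variable; symbol ones with constants from $\Delta$ and "if-else"; integer ones with $0,1,+,-$, all values being clipped to $\{0,\dots,n-1\}$. The program computes $f:\Sigma^*\to\Gamma^*$ *with packed outputs* if, for some $k$, $\Delta$ contains $\Sigma$ and the set $\Gamma^{\le k}$ of strings of length at most $k$, and on every input $w$ a designated output vector has entries in $\Gamma^{\le k}$ whose concatenation is $f(w)$. -/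

import Mathlib

namespace Transduction

/-- The transduction copy-first-half: the first `⌊n/2⌋` symbols of a string of length `n`. -/
def copyFirstHalf {α : Type*} (w : List α) : List α := w.take (w.length / 2)

/-! ### Two-way and pebble transducers -/

/-- Symbols on the input tape: a letter of the input alphabet or one of the two end markers. -/
inductive TapeSymbol (α : Type*) where
  | leftEnd : TapeSymbol α
  | letter (a : α) : TapeSymbol α
  | rightEnd : TapeSymbol α

/-- The tape of `w` has the positions `0, …, |w| + 1`: the left end marker at `0`, the letters
of `w` at `1, …, |w|`, and the right end marker at `|w| + 1`. -/
def tapeSymbol {α : Type*} (w : List α) : ℕ → TapeSymbol α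
  | 0 => .leftEnd
  | p + 1 => match w[p]? with
    | some a => .letter a
    | none => .rightEnd

inductive Move where
  | left
  | stay
  | right

/-- The new head position on a tape with positions `0, …, last`; undefined if the head would
leave the tape. -/
def Move.apply (last : ℕ) : Move → ℕ → Option ℕ
  | .left, 0 => none
  | .left, p + 1 => some p
  | .stay, p => some p
  | .right, p => if p < last then some (p + 1) else none

/-- A (deterministic) two-way transducer with states `Q`, input alphabet `α`, output alphabet `β`.
In state `q` with the head on the symbol `s`, `T.step q s = (u, some (q', m))` means that it writes
`u`, moves the head by `m` and enters `q'`; `T.step q s = (u, none)` means that it writes `u`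
and halts. -/
structure TwoWayTransducer (Q α β : Type*) where
  start : Q
  step : Q → TapeSymbol α → List β × Option (Q × Move)

namespace TwoWayTransducer

/-- `T.Produces w q p v`: on the input `w`, the run of `T` from state `q` and head position `p`
halts, and the string written from there on is `v`. -/
inductive Produces {Q α β : Type*} (T : TwoWayTransducer Q α β) (w : List α) :
    Q → ℕ → List β → Prop where
  | halt {q : Q} {p : ℕ} {u : List β}
      (hstep : T.step q (tapeSymbol w p) = (u, none)) :
      Produces T w q p u
  | move {q q' : Q} {p p' : ℕ} {m : Move} {u v : List β}
      (hstep : T.step q (tapeSymbol w p) = (u, some (q', m)))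
      (hmove : m.apply (w.length + 1) p = some p')
      (hrest : Produces T w q' p' v) :
      Produces T w q p (u ++ v)

/-- `T` defines the total function `f`. -/
def Computes {Q α β : Type*} (T : TwoWayTransducer Q α β) (f : List α → List β) : Prop :=
  ∀ w, T.Produces w T.start 0 (f w)

end TwoWayTransducer

/-- A transduction is regular if it is defined by a two-way transducer with finitely many
states. -/
def IsRegular {α β : Type*} (f : List α → List β) : Prop :=
  ∃ (Q : Type) (_ : Finite Q) (T : TwoWayTransducer Q α β), T.Computes f

/-- What a pebble transducer sees when its head and pebbles are at the positions `ps`, with the head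
first, then the pebbles from the top of the stack to the bottom: all the symbols there, and how
all these positions compare with each other. -/
structure PebbleView (α : Type*) where
  symbols : List (TapeSymbol α)
  order : List (List Ordering)

def pebbleView {α : Type*} (w : List α) (ps : List ℕ) : PebbleView α where
  symbols := ps.map (tapeSymbol w)
  order := ps.map fun p => ps.map fun p' => compare p p'

inductive PebbleAction where
  | move (m : Move)
  | push
  | pop

/-- The effect of an action on head position and stack, when at most `k` pebbles may be on the
stack. Pushing puts the head position on the stack and moves the head to the
beginning of the tape; popping removes the top pebble and moves the head to its position. -/
def PebbleAction.apply (k last : ℕ) : PebbleAction → ℕ × List ℕ → Option (ℕ × List ℕ)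
  | .move m, (p, s) => (m.apply last p).map fun p' => (p', s)
  | .push, (p, s) => if s.length < k then some (0, p :: s) else none
  | .pop, (_, []) => none
  | .pop, (_, p' :: s) => some (p', s)

/-- A (deterministic) pebble transducer. Since runs are restricted to at most `k` pebbles for a
fixed `k`, only finitely many views are ever met when `α` is finite, so that
only a finite part of `step` matters. -/
structure PebbleTransducer (Q α β : Type*) where
  start : Q
  step : Q → PebbleView α → List β × Option (Q × PebbleAction)

namespace PebbleTransducer

/-- `T.Produces k w q c v`: on the input `w` and with at most `k` pebbles, the run of `T` from
state `q` with head position `c.1` and stack `c.2` halts, and the string written from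
there on is `v`. -/
inductive Produces {Q α β : Type*} (T : PebbleTransducer Q α β) (k : ℕ) (w : List α) :
    Q → ℕ × List ℕ → List β → Prop where
  | halt {q : Q} {c : ℕ × List ℕ} {u : List β}
      (hstep : T.step q (pebbleView w (c.1 :: c.2)) = (u, none)) :
      Produces T k w q c u
  | act {q q' : Q} {c c' : ℕ × List ℕ} {a : PebbleAction} {u v : List β}
      (hstep : T.step q (pebbleView w (c.1 :: c.2)) = (u, some (q', a)))
      (hact : a.apply k (w.length + 1) c = some c')
      (hrest : Produces T k w q' c' v) :
      Produces T k w q c (u ++ v)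

/-- `T` with at most `k` pebbles defines the total function `f`. -/
def Computes {Q α β : Type*} (T : PebbleTransducer Q α β) (k : ℕ)
    (f : List α → List β) : Prop :=
  ∀ w, T.Produces k w T.start (0, []) (f w)

end PebbleTransducer

/-- A transduction is polyregular if it is defined by a pebble transducer with finitely many states
and at most `k` pebbles on the stack, for some `k`. -/
def IsPolyregular {α β : Type*} (f : List α → List β) : Prop :=
  ∃ (k : ℕ) (Q : Type) (_ : Finite Q) (T : PebbleTransducer Q α β), T.Computes k f

end Transduction

/-! ### The language B-RASP[pos] -/

namespace BRASP

/-- The types of values. -/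
inductive Ty where
  | bool
  | char
  | nat

/-- Values, over the finite alphabet `Δ` of symbols. -/
abbrev Val (Δ : Type) : Ty → Type
  | .bool => Bool
  | .char => Δ
  | .nat => ℕ

/-- Names of the vectors of type `t` among those defined so far, whose types are `Γ` (the most
recent one first). -/
inductive VecName : List Ty → Ty → Type where
  | last {Γ : List Ty} {t : Ty} : VecName (t :: Γ) t
  | prev {Γ : List Ty} {s t : Ty} (x : VecName Γ t) : VecName (s :: Γ) t

/-- Contents of the vectors of length `n` defined so far. -/
abbrev Env (Δ : Type) (n : ℕ) (Γ : List Ty) : Type :=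
  ∀ t : Ty, VecName Γ t → Fin n → Val Δ t

def Env.nil {Δ : Type} {n : ℕ} : Env Δ n [] := fun _ x => nomatch x

def Env.cons {Δ : Type} {n : ℕ} {Γ : List Ty} {s : Ty} (vec : Fin n → Val Δ s)
    (env : Env Δ n Γ) : Env Δ n (s :: Γ)
  | _, .last => vec
  | _, .prev x => env _ x

/-- Integer expressions in one position variable, which is left implicit. -/
inductive NatExp (Γ : List Ty) where
  | zero
  | one
  | vec (x : VecName Γ .nat)
  | add (e₁ e₂ : NatExp Γ)
  | sub (e₁ e₂ : NatExp Γ)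

/-- Values of integer expressions at position `i`; all values are clipped to `{0, …, n - 1}`. -/
def NatExp.eval {Δ : Type} {n : ℕ} {Γ : List Ty} (env : Env Δ n Γ) (i : Fin n) :
    NatExp Γ → ℕ
  | .zero => 0
  | .one => min 1 (n - 1)
  | .vec x => env .nat x i
  | .add e₁ e₂ => min (e₁.eval env i + e₂.eval env i) (n - 1)
  | .sub e₁ e₂ => e₁.eval env i - e₂.eval env i

inductive Cmp where
  | eq
  | lt
  | le
  | gt
  | ge

def Cmp.eval : Cmp → ℕ → ℕ → Bool
  | .eq, a, b => decide (a = b)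
  | .lt, a, b => decide (a < b)
  | .le, a, b => decide (a ≤ b)
  | .gt, a, b => decide (a > b)
  | .ge, a, b => decide (a ≥ b)

/-- Expressions whose position variables are in `X`. A comparison `cmp` of integers
mentions one position variable only. -/
inductive Exp (Δ : Type) (Γ : List Ty) (X : Type) : Ty → Type where
  | tt : Exp Δ Γ X .bool
  | ff : Exp Δ Γ X .bool
  | boolVec (x : VecName Γ .bool) (i : X) : Exp Δ Γ X .bool
  | charEq (e₁ e₂ : Exp Δ Γ X .char) : Exp Δ Γ X .bool
  | and (e₁ e₂ : Exp Δ Γ X .bool) : Exp Δ Γ X .bool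
  | or (e₁ e₂ : Exp Δ Γ X .bool) : Exp Δ Γ X .bool
  | not (e : Exp Δ Γ X .bool) : Exp Δ Γ X .bool
  | cmp (i : X) (c : Cmp) (e₁ e₂ : NatExp Γ) : Exp Δ Γ X .bool
  | symbol (a : Δ) : Exp Δ Γ X .char
  | charVec (x : VecName Γ .char) (i : X) : Exp Δ Γ X .char
  | ite (b : Exp Δ Γ X .bool) (e₁ e₂ : Exp Δ Γ X .char) : Exp Δ Γ X .char
  | nat (i : X) (e : NatExp Γ) : Exp Δ Γ X .nat

open Classical in
/-- Values of expressions under the assignment `ρ` of positions to position variables. -/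
noncomputable def Exp.eval {Δ : Type} {n : ℕ} {Γ : List Ty} {X : Type} (env : Env Δ n Γ)
    (ρ : X → Fin n) : {t : Ty} → Exp Δ Γ X t → Val Δ t
  | _, .tt => true
  | _, .ff => false
  | _, .boolVec x i => env .bool x (ρ i)
  | _, .charEq e₁ e₂ => decide (e₁.eval env ρ = e₂.eval env ρ)
  | _, .and e₁ e₂ => Bool.and (e₁.eval env ρ) (e₂.eval env ρ)
  | _, .or e₁ e₂ => Bool.or (e₁.eval env ρ) (e₂.eval env ρ)
  | _, .not e => Bool.not (e.eval env ρ)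
  | _, .cmp i c e₁ e₂ => c.eval (e₁.eval env (ρ i)) (e₂.eval env (ρ i))
  | _, .symbol a => a
  | _, .charVec x i => env .char x (ρ i)
  | _, .ite b e₁ e₂ => cond (b.eval env ρ) (e₁.eval env ρ) (e₂.eval env ρ)
  | _, .nat i e => e.eval env (ρ i)

/-- The two position variables of an attention predicate `S(i, j)`. -/
inductive PairVar where
  | i
  | j

inductive Choice where
  | leftmost
  | rightmost

/-- Mask predicates `M(i, j)`: `⊤`, `j < i`, `j ≤ i`, `j > i`, `j ≥ i`. -/
inductive Mask where
  | none
  | lt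
  | le
  | gt
  | ge

def Mask.Holds {n : ℕ} : Mask → Fin n → Fin n → Prop
  | .none, _, _ => True
  | .lt, i, j => j < i
  | .le, i, j => j ≤ i
  | .gt, i, j => j > i
  | .ge, i, j => j ≥ i

/-- Attention predicates `S(i, j)`: a Boolean expression, or a test `V₁(i) = V₂(j)` for
previously defined integer vectors. -/
inductive AttnPred (Δ : Type) (Γ : List Ty) where
  | bool (e : Exp Δ Γ PairVar .bool)
  | natEq (V₁ V₂ : VecName Γ .nat)

def AttnPred.Holds {Δ : Type} {n : ℕ} {Γ : List Ty} (env : Env Δ n Γ) :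
    AttnPred Δ Γ → Fin n → Fin n → Prop
  | .bool e, i, j => e.eval env (fun | .i => i | .j => j) = true
  | .natEq V₁ V₂, i, j => env .nat V₁ i = env .nat V₂ j

/-- Right-hand sides of definitions of vectors of type `t`: position-wise operations and
attention operations. -/
inductive Rhs (Δ : Type) (Γ : List Ty) (t : Ty) where
  | pointwise (e : Exp Δ Γ Unit t)
  | attention (choice : Choice) (M : Mask) (S : AttnPred Δ Γ) (V D : Exp Δ Γ Unit t)

open Classical in
/-- The positions `j` with `M(i, j)` and `S(i, j)`. -/
noncomputable def attended {Δ : Type} {n : ℕ} {Γ : List Ty} (env : Env Δ n Γ) (M : Mask)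
    (S : AttnPred Δ Γ) (i : Fin n) : Finset (Fin n) :=
  Finset.univ.filter fun j => M.Holds i j ∧ S.Holds env i j

noncomputable def Choice.pick {n : ℕ} (s : Finset (Fin n)) (hs : s.Nonempty) :
    Choice → Fin n
  | .leftmost => s.min' hs
  | .rightmost => s.max' hs

open Classical in
noncomputable def Rhs.eval {Δ : Type} {n : ℕ} {Γ : List Ty} {t : Ty} (env : Env Δ n Γ) :
    Rhs Δ Γ t → Fin n → Val Δ t
  | .pointwise e, i => e.eval env fun _ => i
  | .attention choice M S V D, i =>
      if h : (attended env M S i).Nonempty then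
        V.eval env fun _ => choice.pick (attended env M S i) h
      else D.eval env fun _ => i

/-- Programs that can refer to vectors of the types `Γ`: a sequence of definitions, then the choice
of the output vector. -/
inductive Program (Δ : Type) : List Ty → Type where
  | out {Γ : List Ty} (x : VecName Γ .char) : Program Δ Γ
  | define {Γ : List Ty} {t : Ty} (r : Rhs Δ Γ t) (P : Program Δ (t :: Γ)) : Program Δ Γ

/-- The contents of the output vector. -/
noncomputable def Program.eval {Δ : Type} {n : ℕ} : {Γ : List Ty} → Program Δ Γ → Env Δ n Γ →
    Fin n → Δ
  | _, .out x, env => env .char x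
  | _, .define r P, env => P.eval (env.cons (r.eval env))

/-- The predefined vectors: the input `in`, and `pos` with `pos(i) = i`. -/
def initialEnv {Δ : Type} {n : ℕ} (input : Fin n → Δ) : Env Δ n [.char, .nat] :=
  Env.cons (s := .char) input (Env.cons (s := .nat) (fun i => (i : ℕ)) Env.nil)

/-- Strings of length at most `k`, the symbols of packed outputs. -/
abbrev Packed (β : Type*) (k : ℕ) : Type _ := {u : List β // u.length ≤ k}

/-- `f` is computed by a B-RASP[pos] program with packed outputs: for some `k`, a finite alphabet
`Δ` containing (through `inSym` and `outSym`) the input alphabet `α` and the set of strings of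
length at most `k` over `β`, and a program over `Δ`, the output vector on each input `w`
consists of packed symbols whose concatenation is `f w`. -/
def Computable {α β : Type*} (f : List α → List β) : Prop :=
  ∃ (k : ℕ) (Δ : Type) (_ : Finite Δ) (inSym : α ↪ Δ) (outSym : Packed β k ↪ Δ)
    (P : Program Δ [.char, .nat]),
    ∀ w : List α, ∃ u : Fin w.length → Packed β k,
      P.eval (initialEnv fun i => inSym (w.get i)) = (fun i => outSym (u i)) ∧
        (List.ofFn fun i => (u i).val).flatten = f w

end BRASP

/-!
Pebble transducers preserve regularity under inverse images. If `f` is polyregular and `L` is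
regular, then running an automaton for `L` on the output of a transducer for `f` gives a
nondeterministic pebble automaton for `{w | f w ∈ L}`. Consider the part of a run above a pushed
pebble: whether it can halt, or pop the pebble and go on in a given state, is a least fixed point
which is definable in monadic second-order logic from the same relations for one pebble more. Since
a property of words with marked positions that is definable in this logic has only finitely many
Nerode residuals, `{w | f w ∈ L}` is regular by the Myhill–Nerode theorem. But `b` occurs in the
first half of `aᵐ b aᵖ` if and only if `m < p`, so that the inverse image under copy-first-half of
the words containing `b` is not regular.
-/

namespace Transduction

section MarkedWords

variable {B C ι Y Y' Y'' : Type*}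

/-- A word with a position for each variable in `ι`, the structures in which monadic second-order
formulas are interpreted. The letters are `label 0, …, label (length - 1)`; the values of `label`
from `length` on are junk. -/
@[ext]
structure MarkedWord (B ι : Type*) where
  length : ℕ
  label : ℕ → B
  pos : ι → ℕ
  pos_lt (v : ι) : pos v < length

/-- The part of a marked word before a cut. The variables with value `none` stand for positions
after the cut. -/
structure MarkedPrefix (B ι : Type*) where
  length : ℕ
  label : ℕ → B
  pos : ι → Option ℕ
  pos_lt (v : ι) : ∀ p ∈ pos v, p < length

/-- The labelling that agrees with `X` on `0, …, n - 1` and continues with `Z` from `n` on. -/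
def glue (n : ℕ) (X Z : ℕ → B) (i : ℕ) : B := if i < n then X i else Z (i - n)

theorem glue_of_lt {n i : ℕ} (X Z : ℕ → B) (h : i < n) : glue n X Z i = X i := if_pos h

theorem glue_add (n i : ℕ) (X Z : ℕ → B) : glue n X Z (n + i) = Z i := by simp [glue]

theorem glue_add_left_self (n : ℕ) (X : ℕ → B) : glue n X (fun i => X (n + i)) = X := by
  funext i
  rcases lt_or_ge i n with h | h
  · exact glue_of_lt _ _ h
  · obtain ⟨j, rfl⟩ := Nat.exists_eq_add_of_le h
    exact glue_add ..

theorem glue_map (g : B → C) (n : ℕ) (X Z : ℕ → B) :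
    (fun i => g (glue n X Z i)) = glue n (fun i => g (X i)) fun i => g (Z i) :=
  funext fun _ => apply_ite g _ _ _

theorem glue_prodMk (n : ℕ) (X Z : ℕ → B) (V U : ℕ → C) :
    (fun i => (glue n X Z i, glue n V U i)) =
      glue n (fun i => (X i, V i)) fun i => (Z i, U i) := by
  funext i
  unfold glue
  split_ifs <;> rfl

namespace MarkedWord

/-- The marked word `W` with its letters replaced by their images under `g`. -/
def mapLabel (W : MarkedWord B ι) (g : B → C) : MarkedWord C ι where
  __ := W
  label i := g (W.label i)

/-- The marked word `W` with `V` as an additional labelling, the value of a second-order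
variable. -/
def zipLabel (W : MarkedWord B ι) (V : ℕ → C) : MarkedWord (B × C) ι where
  __ := W
  label i := (W.label i, V i)

/-- The marked word `W` with the variable `v` moved to the position `p`. -/
def mark [DecidableEq ι] (W : MarkedWord B ι) (v : ι) (p : Fin W.length) : MarkedWord B ι where
  __ := W
  pos := Function.update W.pos v p
  pos_lt := Function.forall_update_iff W.pos (p := fun _ q => q < W.length) |>.2
    ⟨p.isLt, fun u _ => W.pos_lt u⟩

@[simp]
theorem pos_mark_self [DecidableEq ι] (W : MarkedWord B ι) (v : ι) (p : Fin W.length) :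
    (W.mark v p).pos v = p :=
  Function.update_self ..

theorem pos_mark_of_ne [DecidableEq ι] (W : MarkedWord B ι) {u v : ι} (h : u ≠ v)
    (p : Fin W.length) : (W.mark v p).pos u = W.pos u :=
  Function.update_of_ne h ..

@[simp]
theorem length_mark [DecidableEq ι] (W : MarkedWord B ι) (v : ι) (p : Fin W.length) :
    (W.mark v p).length = W.length :=
  rfl

@[simp]
theorem label_mark [DecidableEq ι] (W : MarkedWord B ι) (v : ι) (p : Fin W.length) :
    (W.mark v p).label = W.label :=
  rfl

end MarkedWord

namespace MarkedPrefix

/-- The prefix `P` with its letters replaced by their images under `g`. -/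
def mapLabel (P : MarkedPrefix B ι) (g : B → C) : MarkedPrefix C ι where
  __ := P
  label i := g (P.label i)

/-- The prefix `P` with `V` as an additional labelling. -/
def zipLabel (P : MarkedPrefix B ι) (V : ℕ → C) : MarkedPrefix (B × C) ι where
  __ := P
  label i := (P.label i, V i)

/-- The prefix `P` with the variable `v` moved to the position `o`, or behind the cut if `o` is
`none`. -/
def place [DecidableEq ι] (P : MarkedPrefix B ι) (v : ι) (o : Option (Fin P.length)) :
    MarkedPrefix B ι where
  __ := P
  pos := Function.update P.pos v (o.map Fin.val)
  pos_lt := Function.forall_update_iff P.pos (p := fun _ x => ∀ q ∈ x, q < P.length) |>.2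
    ⟨by simp +contextual, fun u _ => P.pos_lt u⟩

/-- The word with the prefix `P` and, behind the cut, the rest `Z`. The position in `Z` of a
variable that `P` has placed already is ignored. -/
def append (P : MarkedPrefix B ι) (Z : MarkedWord B ι) : MarkedWord B ι where
  length := P.length + Z.length
  label := glue P.length P.label Z.label
  pos v := (P.pos v).getD (P.length + Z.pos v)
  pos_lt v := by
    have hZ := Z.pos_lt v
    cases h : P.pos v with
    | none => simpa using hZ
    | some p => simpa using (P.pos_lt v p h).trans_le (Nat.le_add_right ..)

theorem append_mapLabel (P : MarkedPrefix B ι) (Z : MarkedWord B ι) (g : B → C) :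
    (P.append Z).mapLabel g = (P.mapLabel g).append (Z.mapLabel g) :=
  MarkedWord.ext rfl (glue_map ..) rfl

theorem append_zipLabel (P : MarkedPrefix B ι) (Z : MarkedWord B ι) (V U : ℕ → C) :
    (P.append Z).zipLabel (glue P.length V U) = (P.zipLabel V).append (Z.zipLabel U) :=
  MarkedWord.ext rfl (glue_prodMk ..) rfl

theorem append_mark_castAdd [DecidableEq ι] (P : MarkedPrefix B ι) (Z : MarkedWord B ι) (v : ι)
    (p : Fin P.length) :
    (P.append Z).mark v (p.castAdd Z.length) = (P.place v (some p)).append Z := by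
  refine MarkedWord.ext rfl rfl (funext fun u => ?_)
  by_cases h : u = v
  · subst h; simp [MarkedWord.mark, append, place]
  · simp [MarkedWord.mark, append, place, h]

theorem append_mark_natAdd [DecidableEq ι] (P : MarkedPrefix B ι) (Z : MarkedWord B ι) (v : ι)
    (p : Fin Z.length) :
    (P.append Z).mark v (p.natAdd P.length) = (P.place v none).append (Z.mark v p) := by
  refine MarkedWord.ext rfl rfl (funext fun u => ?_)
  by_cases h : u = v
  · subst h; simp [MarkedWord.mark, append, place]
  · simp [MarkedWord.mark, append, place, h]

theorem exists_zipLabel_append_iff {Φ : MarkedWord (B × C) ι → Prop} (P : MarkedPrefix B ι)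
    (Z : MarkedWord B ι) :
    (∃ V, Φ ((P.append Z).zipLabel V)) ↔
      ∃ V U, Φ ((P.zipLabel V).append (Z.zipLabel U)) := by
  constructor
  · rintro ⟨V, hV⟩
    refine ⟨V, fun i => V (P.length + i), ?_⟩
    rwa [← append_zipLabel, glue_add_left_self]
  · rintro ⟨V, U, h⟩
    exact ⟨_, (append_zipLabel P Z V U).symm ▸ h⟩

theorem exists_mark_append_iff [DecidableEq ι] {Φ : MarkedWord B ι → Prop} (P : MarkedPrefix B ι)
    (Z : MarkedWord B ι) (v : ι) :
    (∃ p, Φ ((P.append Z).mark v p)) ↔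
      (∃ p, Φ ((P.place v (some p)).append Z)) ∨
        ∃ p, Φ ((P.place v none).append (Z.mark v p)) := by
  simp only [← append_mark_castAdd, ← append_mark_natAdd]
  constructor
  · rintro ⟨p, hp⟩
    induction p using Fin.addCases with
    | left p => exact .inl ⟨p, hp⟩
    | right p => exact .inr ⟨p, hp⟩
  · rintro (⟨p, hp⟩ | ⟨p, hp⟩)
    exacts [⟨_, hp⟩, ⟨_, hp⟩]

end MarkedPrefix

/-- The Nerode residual of `Φ` at the prefix `P`: what `Φ` makes of the continuations of `P`. -/
def residual (Φ : MarkedWord B ι → Y) (P : MarkedPrefix B ι) (Z : MarkedWord B ι) : Y :=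
  Φ (P.append Z)

/-- A function of marked words has finite index if it has only finitely many residuals. This is the
analogue, for words with marked positions, of the Myhill–Nerode condition for regular languages. -/
def FiniteIndex (Φ : MarkedWord B ι → Y) : Prop := (Set.range (residual Φ)).Finite

namespace FiniteIndex

theorem of_residual_eq {S : Type*} {Φ : MarkedWord B ι → Y} (τ : MarkedPrefix B ι → S)
    (F : S → MarkedWord B ι → Y) (hτ : (Set.range τ).Finite)
    (h : ∀ P Z, Φ (P.append Z) = F (τ P) Z) : FiniteIndex Φ := by
  refine (hτ.image F).subset ?_
  rintro _ ⟨P, rfl⟩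
  exact ⟨τ P, ⟨P, rfl⟩, (funext (h P)).symm⟩

theorem congr {Φ Ψ : MarkedWord B ι → Y} (hΦ : FiniteIndex Φ) (h : ∀ W, Φ W = Ψ W) :
    FiniteIndex Ψ :=
  funext h ▸ hΦ

theorem const (y : Y) : FiniteIndex fun _ : MarkedWord B ι => y :=
  of_residual_eq (fun _ => ()) (fun _ _ => y) (Set.toFinite _) fun _ _ => rfl

theorem map {Φ : MarkedWord B ι → Y} (hΦ : FiniteIndex Φ) (h : Y → Y') :
    FiniteIndex fun W => h (Φ W) :=
  of_residual_eq (residual Φ) (fun ρ Z => h (ρ Z)) hΦ fun _ _ => rfl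

theorem map₂ {Φ : MarkedWord B ι → Y} {Ψ : MarkedWord B ι → Y'} (hΦ : FiniteIndex Φ)
    (hΨ : FiniteIndex Ψ) (h : Y → Y' → Y'') : FiniteIndex fun W => h (Φ W) (Ψ W) :=
  of_residual_eq (fun P => (residual Φ P, residual Ψ P)) (fun ρ Z => h (ρ.1 Z) (ρ.2 Z))
    ((hΦ.prod hΨ).subset (Set.range_pair_subset ..)) fun _ _ => rfl

theorem pi {κ : Type*} [Finite κ] {Φ : κ → MarkedWord B ι → Y} (hΦ : ∀ i, FiniteIndex (Φ i)) :
    FiniteIndex fun W i => Φ i W := by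
  refine of_residual_eq (fun P i => residual (Φ i) P) (fun ρ Z i => ρ i Z)
    ((Set.Finite.pi' hΦ).subset ?_) fun _ _ => rfl
  rintro _ ⟨P, rfl⟩ i
  exact ⟨P, rfl⟩

theorem listMap {κ : Type*} {Φ : κ → MarkedWord B ι → Y} (hΦ : ∀ i, FiniteIndex (Φ i))
    (l : List κ) : FiniteIndex fun W => l.map fun i => Φ i W := by
  induction l with
  | nil => exact const []
  | cons i l ih => exact (hΦ i).map₂ ih List.cons

theorem not {Φ : MarkedWord B ι → Prop} (hΦ : FiniteIndex Φ) : FiniteIndex fun W => ¬ Φ W :=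
  hΦ.map Not

theorem and {Φ Ψ : MarkedWord B ι → Prop} (hΦ : FiniteIndex Φ) (hΨ : FiniteIndex Ψ) :
    FiniteIndex fun W => Φ W ∧ Ψ W :=
  hΦ.map₂ hΨ And

theorem or {Φ Ψ : MarkedWord B ι → Prop} (hΦ : FiniteIndex Φ) (hΨ : FiniteIndex Ψ) :
    FiniteIndex fun W => Φ W ∨ Ψ W :=
  hΦ.map₂ hΨ Or

theorem imp {Φ Ψ : MarkedWord B ι → Prop} (hΦ : FiniteIndex Φ) (hΨ : FiniteIndex Ψ) :
    FiniteIndex fun W => Φ W → Ψ W :=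
  hΦ.map₂ hΨ (· → ·)

theorem exists_finite {κ : Type*} [Finite κ] {Φ : κ → MarkedWord B ι → Prop}
    (hΦ : ∀ i, FiniteIndex (Φ i)) : FiniteIndex fun W => ∃ i, Φ i W :=
  (pi hΦ).map Exists

theorem forall_finite {κ : Type*} [Finite κ] {Φ : κ → MarkedWord B ι → Prop}
    (hΦ : ∀ i, FiniteIndex (Φ i)) : FiniteIndex fun W => ∀ i, Φ i W :=
  (pi hΦ).map fun P => ∀ i, P i

theorem mapLabel {Φ : MarkedWord C ι → Y} (hΦ : FiniteIndex Φ) (g : B → C) :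
    FiniteIndex fun W => Φ (W.mapLabel g) :=
  of_residual_eq (fun P => residual Φ (P.mapLabel g)) (fun ρ Z => ρ (Z.mapLabel g))
    (hΦ.subset (Set.range_comp_subset_range (MarkedPrefix.mapLabel · g) (residual Φ)))
    fun P Z => congrArg Φ (P.append_mapLabel Z g)

theorem exists_labelling {Φ : MarkedWord (B × C) ι → Prop} (hΦ : FiniteIndex Φ) :
    FiniteIndex fun W => ∃ V, Φ (W.zipLabel V) := by
  -- The subset construction: remember the residuals for all labellings of the prefix.
  refine of_residual_eq (fun P => Set.range fun V => residual Φ (P.zipLabel V))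
    (fun R Z => ∃ ρ ∈ R, ∃ U, ρ (Z.zipLabel U)) (hΦ.finite_subsets.subset ?_) fun P Z => ?_
  · rintro _ ⟨P, rfl⟩
    exact Set.range_comp_subset_range P.zipLabel (residual Φ)
  · simp only [Set.exists_range_iff]
    exact propext (P.exists_zipLabel_append_iff Z)

theorem exists_position [DecidableEq ι] {Φ : MarkedWord B ι → Prop} (hΦ : FiniteIndex Φ) (v : ι) :
    FiniteIndex fun W => ∃ p, Φ (W.mark v p) := by
  refine of_residual_eq
    (fun P => (Set.range fun p => residual Φ (P.place v (some p)), residual Φ (P.place v none)))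
    (fun R Z => (∃ ρ ∈ R.1, ρ Z) ∨ ∃ p, R.2 (Z.mark v p))
    ((hΦ.finite_subsets.prod hΦ).subset ?_) fun P Z => ?_
  · rintro _ ⟨P, rfl⟩
    exact ⟨Set.range_comp_subset_range (P.place v ∘ some) (residual Φ), ⟨_, rfl⟩⟩
  · simp only [Set.exists_range_iff]
    exact propext (P.exists_mark_append_iff Z v)

theorem forall_position [DecidableEq ι] {Φ : MarkedWord B ι → Prop} (hΦ : FiniteIndex Φ) (v : ι) :
    FiniteIndex fun W => ∀ p, Φ (W.mark v p) := by
  simpa only [not_exists, not_not] using (hΦ.not.exists_position v).not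

theorem label [Finite B] (v : ι) : FiniteIndex fun W : MarkedWord B ι => W.label (W.pos v) := by
  refine of_residual_eq (fun P => (P.pos v).map P.label)
    (fun o Z => o.getD (Z.label (Z.pos v))) (Set.toFinite _) fun P Z => ?_
  cases h : P.pos v with
  | none => simp [MarkedPrefix.append, h, glue_add]
  | some p => simp [MarkedPrefix.append, h, glue_of_lt _ _ (P.pos_lt v p h)]

theorem pos_lt_pos (u v : ι) : FiniteIndex fun W : MarkedWord B ι => W.pos u < W.pos v := by
  refine of_residual_eq
    (fun P => ((P.pos u).getD P.length < (P.pos v).getD P.length, P.pos u = none ∧ P.pos v = none))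
    (fun t Z => t.1 ∨ t.2 ∧ Z.pos u < Z.pos v) (Set.toFinite _) fun P Z => ?_
  have hu := P.pos_lt u
  have hv := P.pos_lt v
  cases h : P.pos u <;> cases h' : P.pos v <;> simp_all [MarkedPrefix.append] <;> omega

theorem compare_pos (u v : ι) :
    FiniteIndex fun W : MarkedWord B ι => compare (W.pos u) (W.pos v) := by
  classical
  exact ((pos_lt_pos u v).map₂ (pos_lt_pos v u) fun a b =>
    if a then Ordering.lt else if b then Ordering.gt else Ordering.eq).congr fun W =>
      by convert (Nat.compare_eq_ite_lt ..).symm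

theorem pos_eq_pos (u v : ι) : FiniteIndex fun W : MarkedWord B ι => W.pos u = W.pos v := by
  simpa only [compare_eq_iff_eq] using (compare_pos u v).map (· = .eq)

theorem pos_eq_zero [Infinite ι] (v : ι) :
    FiniteIndex fun W : MarkedWord B ι => W.pos v = 0 := by
  classical
  obtain ⟨w, hw⟩ := Infinite.exists_notMem_finset {v}
  have hvw : v ≠ w := by simpa [eq_comm] using hw
  refine ((pos_lt_pos w v).exists_position w).not.congr fun W => propext ?_
  simp only [MarkedWord.pos_mark_self, MarkedWord.pos_mark_of_ne _ hvw]
  refine ⟨fun h => ?_, fun h => by simp [h]⟩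
  by_contra hv
  exact h ⟨⟨0, Nat.zero_lt_of_lt (W.pos_lt v)⟩, Nat.pos_of_ne_zero hv⟩

theorem pos_add_one_eq_pos [Infinite ι] (u v : ι) :
    FiniteIndex fun W : MarkedWord B ι => W.pos u + 1 = W.pos v := by
  classical
  obtain ⟨w, hw⟩ := Infinite.exists_notMem_finset {u, v}
  obtain ⟨huw, hvw⟩ : u ≠ w ∧ v ≠ w := by simpa [eq_comm] using hw
  refine ((pos_lt_pos u v).and
    (((pos_lt_pos u w).and (pos_lt_pos w v)).exists_position w).not).congr fun W => propext ?_
  simp only [MarkedWord.pos_mark_self, MarkedWord.pos_mark_of_ne _ huw,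
    MarkedWord.pos_mark_of_ne _ hvw]
  refine ⟨fun ⟨hlt, h⟩ => ?_, fun h => ⟨by omega, fun ⟨_, _⟩ => by omega⟩⟩
  by_contra hne
  exact h ⟨⟨W.pos u + 1, Nat.lt_of_le_of_lt hlt (W.pos_lt v)⟩, Nat.lt_succ_self _,
    Nat.lt_of_le_of_ne hlt hne⟩

theorem leastFixedPoint [DecidableEq ι] {Q : Type*} [Finite Q] {base : Q → MarkedWord B ι → Prop}
    {edge : Q → Q → MarkedWord B ι → Prop} (hbase : ∀ q, FiniteIndex (base q))
    (hedge : ∀ q q', FiniteIndex (edge q q')) {u v : ι} (huv : u ≠ v) (q₀ : Q) :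
    FiniteIndex fun W : MarkedWord B ι => ∀ V : ℕ → Q → Prop,
      (∀ p q, base q (W.mark u p) → V p q) →
      (∀ p p' q q', edge q q' ((W.mark u p).mark v p') → V p' q' → V p q) →
      V (W.pos u) q₀ := by
  -- Quantifying over `V` is quantifying over labellings by sets of states.
  have member (q : Q) (x : ι) : FiniteIndex fun W : MarkedWord (B × (Q → Prop)) ι =>
      (W.label (W.pos x)).2 q :=
    ((label x).map fun V : Q → Prop => V q).mapLabel Prod.snd
  have containsBase : FiniteIndex fun W : MarkedWord (B × (Q → Prop)) ι =>
      ∀ p q, base q ((W.mark u p).mapLabel Prod.fst) → (W.label p).2 q := by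
    simpa only [MarkedWord.pos_mark_self, MarkedWord.label_mark] using
      (forall_finite fun q => ((hbase q).mapLabel Prod.fst).imp (member q u)).forall_position u
  have closedUnderEdges : FiniteIndex fun W : MarkedWord (B × (Q → Prop)) ι =>
      ∀ p p' q q', edge q q' (((W.mark u p).mark v p').mapLabel Prod.fst) →
        (W.label p').2 q' → (W.label p).2 q := by
    have h := ((forall_finite fun q => forall_finite fun q' =>
      ((hedge q q').mapLabel Prod.fst).imp
        ((member q' v).imp (member q u))).forall_position v).forall_position u
    simpa only [MarkedWord.pos_mark_self, MarkedWord.pos_mark_of_ne _ huv,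
      MarkedWord.label_mark] using h
  have h := (containsBase.imp (closedUnderEdges.imp (member q₀ u))).not.exists_labelling.not
  simp only [not_exists, not_not] at h
  exact h

end FiniteIndex

end MarkedWords

section PebbleAutomata

variable {Q α : Type*}

theorem Move.le_of_apply_eq_some {m : Move} {last p p' : ℕ} (h : m.apply last p = some p')
    (hp : p ≤ last) : p' ≤ last := by
  cases m <;> cases p <;> simp_all [Move.apply] <;> omega

/-- What a pebble automaton sees at the positions `ps` of a tape with the symbols `X`. -/
def tapeView (X : ℕ → TapeSymbol α) (ps : List ℕ) : PebbleView α where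
  symbols := ps.map X
  order := ps.map fun p => ps.map fun p' => compare p p'

/-- A nondeterministic pebble automaton, which accepts by halting. -/
structure PebbleAutomaton (Q α : Type*) where
  halts : Q → PebbleView α → Prop
  next : Q → PebbleView α → Q → PebbleAction → Prop

namespace PebbleAutomaton

/-- `A.Accepts k last X q c`: on the tape with the symbols `X 0, …, X last`, some run of `A` with at
most `k` pebbles halts that starts in state `q` with head position `c.1` and stack `c.2`. -/
inductive Accepts (A : PebbleAutomaton Q α) (k last : ℕ) (X : ℕ → TapeSymbol α) :
    Q → ℕ × List ℕ → Prop where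
  | halt {q : Q} {c : ℕ × List ℕ} (hhalt : A.halts q (tapeView X (c.1 :: c.2))) :
      Accepts A k last X q c
  | act {q q' : Q} {c c' : ℕ × List ℕ} {a : PebbleAction}
      (hnext : A.next q (tapeView X (c.1 :: c.2)) q' a) (hact : a.apply k last c = some c')
      (hrest : Accepts A k last X q' c') : Accepts A k last X q c

/-- `A.Outcome k last X s ρ q p`: some run from state `q`, head position `p` and stack `s` halts
before it pops a pebble of `s` (if `ρ = none`), or pops its first pebble of `s` with a transition to
the state `q'` (if `ρ = some q'`). A run above a pushed pebble enters only through its own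
outcome, so that no constructor looks below the top of the stack. -/
inductive Outcome (A : PebbleAutomaton Q α) (k last : ℕ) (X : ℕ → TapeSymbol α) :
    List ℕ → Option Q → Q → ℕ → Prop where
  | halt {s : List ℕ} {q : Q} {p : ℕ} (hhalt : A.halts q (tapeView X (p :: s))) :
      Outcome A k last X s none q p
  | pop {s : List ℕ} {q q' : Q} {p : ℕ} (hnext : A.next q (tapeView X (p :: s)) q' .pop) :
      Outcome A k last X s (some q') q p
  | move {s : List ℕ} {ρ : Option Q} {q q' : Q} {p p' : ℕ} {m : Move}
      (hnext : A.next q (tapeView X (p :: s)) q' (.move m)) (hmove : m.apply last p = some p')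
      (hrest : Outcome A k last X s ρ q' p') : Outcome A k last X s ρ q p
  | pushHalt {s : List ℕ} {q q' : Q} {p : ℕ} (hnext : A.next q (tapeView X (p :: s)) q' .push)
      (hroom : s.length < k) (hcall : Outcome A k last X (p :: s) none q' 0) :
      Outcome A k last X s none q p
  | pushPop {s : List ℕ} {ρ : Option Q} {q q₁ q₂ : Q} {p : ℕ}
      (hnext : A.next q (tapeView X (p :: s)) q₁ .push) (hroom : s.length < k)
      (hcall : Outcome A k last X (p :: s) (some q₂) q₁ 0)
      (hrest : Outcome A k last X s ρ q₂ p) : Outcome A k last X s ρ q p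

/-- An accepting run cut at the moments when it pops a pebble of the initial stack `s`. -/
inductive Unwinds (A : PebbleAutomaton Q α) (k last : ℕ) (X : ℕ → TapeSymbol α) :
    List ℕ → Q → ℕ → Prop where
  | halt {s : List ℕ} {q : Q} {p : ℕ} (houtcome : A.Outcome k last X s none q p) :
      Unwinds A k last X s q p
  | pop {s : List ℕ} {q q' : Q} {p p' : ℕ} (houtcome : A.Outcome k last X (p' :: s) (some q') q p)
      (hrest : Unwinds A k last X s q' p') : Unwinds A k last X (p' :: s) q p

variable {A : PebbleAutomaton Q α} {k last : ℕ} {X : ℕ → TapeSymbol α} {s : List ℕ} {q q' : Q}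
  {p p' : ℕ} {ρ : Option Q}

theorem Unwinds.imp (h : A.Unwinds k last X s q' p')
    (himp : ∀ ρ, A.Outcome k last X s ρ q' p' → A.Outcome k last X s ρ q p) :
    A.Unwinds k last X s q p := by
  cases h with
  | halt houtcome => exact .halt (himp _ houtcome)
  | pop houtcome hrest => exact .pop (himp _ houtcome) hrest

theorem Accepts.unwinds {c : ℕ × List ℕ} (h : A.Accepts k last X q c) :
    A.Unwinds k last X c.2 q c.1 := by
  induction h with
  | halt hhalt => exact .halt (.halt hhalt)
  | @act q q' c c' a hnext hact hrest ih =>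
    obtain ⟨p, s⟩ := c
    match a, s with
    | .move m, s =>
      obtain ⟨p', hmove, rfl⟩ := Option.map_eq_some_iff.1 hact
      exact ih.imp fun ρ => .move hnext hmove
    | .push, s =>
      obtain ⟨hroom, rfl⟩ : s.length < k ∧ (0, p :: s) = c' := by
        simpa [PebbleAction.apply] using hact
      cases ih with
      | halt hcall => exact .halt (.pushHalt hnext hroom hcall)
      | pop hcall hunwinds => exact hunwinds.imp fun ρ => .pushPop hnext hroom hcall
    | .pop, p' :: s =>
      obtain rfl : (p', s) = c' := by simpa [PebbleAction.apply] using hact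
      exact .pop (.pop hnext) ih

/-- The condition under which a run over the stack `s` with outcome `ρ` extends to an accepting
run. -/
def Resumes (A : PebbleAutomaton Q α) (k last : ℕ) (X : ℕ → TapeSymbol α) :
    Option Q → List ℕ → Prop
  | none, _ => True
  | some _, [] => False
  | some q, p :: s => A.Accepts k last X q (p, s)

theorem Outcome.accepts (h : A.Outcome k last X s ρ q p) (hρ : A.Resumes k last X ρ s) :
    A.Accepts k last X q (p, s) := by
  induction h with
  | halt hhalt => exact .halt hhalt
  | @pop s _ _ _ hnext =>
    match s, hρ with
    | p' :: s, hρ => exact .act hnext rfl hρ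
  | move hnext hmove _ ih => exact .act hnext (by simp [PebbleAction.apply, hmove]) (ih hρ)
  | pushHalt hnext hroom _ ih =>
    exact .act hnext (if_pos hroom) (ih trivial)
  | pushPop hnext hroom _ _ ihcall ihrest =>
    exact .act hnext (if_pos hroom) (ihcall (ihrest hρ))

theorem accepts_iff_outcome : A.Accepts k last X q (p, []) ↔ A.Outcome k last X [] none q p := by
  refine ⟨fun h => ?_, fun h => h.accepts trivial⟩
  cases h.unwinds with
  | halt houtcome => exact houtcome

/-- `A.Calls k last X s q p ρ`: in state `q` at position `p`, the automaton can push a pebble such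
that the run above it has the outcome `ρ`. -/
def Calls (A : PebbleAutomaton Q α) (k last : ℕ) (X : ℕ → TapeSymbol α) (s : List ℕ) (q : Q)
    (p : ℕ) (ρ : Option Q) : Prop :=
  ∃ q', A.next q (tapeView X (p :: s)) q' .push ∧ s.length < k ∧
    A.Outcome k last X (p :: s) ρ q' 0

/-- The base clauses of `Outcome`. -/
def Exits (A : PebbleAutomaton Q α) (k last : ℕ) (X : ℕ → TapeSymbol α) (s : List ℕ) :
    Option Q → Q → ℕ → Prop
  | none, q, p => A.halts q (tapeView X (p :: s)) ∨ A.Calls k last X s q p none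
  | some q', q, p => A.next q (tapeView X (p :: s)) q' .pop

/-- The recursive clauses of `Outcome`: the automaton gets from `q` and `p` to `q'` and `p'` by a
move of its head or by a run above a pushed pebble. -/
def Advances (A : PebbleAutomaton Q α) (k last : ℕ) (X : ℕ → TapeSymbol α) (s : List ℕ)
    (q : Q) (p : ℕ) (q' : Q) (p' : ℕ) : Prop :=
  (∃ m, A.next q (tapeView X (p :: s)) q' (.move m) ∧ m.apply last p = some p') ∨
    p = p' ∧ A.Calls k last X s q p (some q')

theorem Outcome.of_exits (h : A.Exits k last X s ρ q p) : A.Outcome k last X s ρ q p := by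
  match ρ, h with
  | none, .inl hhalt => exact .halt hhalt
  | none, .inr ⟨_, hnext, hroom, hcall⟩ => exact .pushHalt hnext hroom hcall
  | some _, hnext => exact .pop hnext

theorem Outcome.of_advances (h : A.Advances k last X s q p q' p')
    (hrest : A.Outcome k last X s ρ q' p') : A.Outcome k last X s ρ q p := by
  obtain ⟨m, hnext, hmove⟩ | ⟨rfl, _, hnext, hroom, hcall⟩ := h
  · exact .move hnext hmove hrest
  · exact .pushPop hnext hroom hcall hrest

theorem outcome_iff_forall {n : ℕ} (hp : p < n) :
    A.Outcome k (n - 1) X s ρ q p ↔ ∀ V : ℕ → Q → Prop,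
      (∀ (p : Fin n) q, A.Exits k (n - 1) X s ρ q p → V p q) →
      (∀ (p p' : Fin n) q q', A.Advances k (n - 1) X s q p q' p' → V p' q' → V p q) →
      V p q := by
  refine ⟨fun h V hexits hadvances => ?_,
    fun h => h (fun p q => A.Outcome k (n - 1) X s ρ q p) (fun _ _ => .of_exits)
      fun _ _ _ _ => .of_advances⟩
  induction h with
  | halt hhalt => exact hexits ⟨_, hp⟩ _ (.inl hhalt)
  | pop hnext => exact hexits ⟨_, hp⟩ _ hnext
  | pushHalt hnext hroom hcall _ => exact hexits ⟨_, hp⟩ _ (.inr ⟨_, hnext, hroom, hcall⟩)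
  | @move _ _ _ _ p p' _ hnext hmove _ ih =>
    have hp' : p' < n := by have := Move.le_of_apply_eq_some hmove (by omega); omega
    exact hadvances ⟨p, hp⟩ ⟨p', hp'⟩ _ _ (.inl ⟨_, hnext, hmove⟩) (ih hp' hexits hadvances)
  | @pushPop _ _ _ _ _ p hnext hroom hcall _ _ ih =>
    exact hadvances ⟨p, hp⟩ ⟨p, hp⟩ _ _ (.inr ⟨rfl, _, hnext, hroom, hcall⟩)
      (ih hp hexits hadvances)

end PebbleAutomaton

instance : Finite Move :=
  .of_injective (β := Fin 3) (fun | .left => 0 | .stay => 1 | .right => 2) fun m m' h => by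
    cases m <;> cases m' <;> first | rfl | contradiction

instance [Finite α] : Finite (TapeSymbol α) :=
  .of_injective (β := Option (Option α))
    (fun | .leftEnd => none | .letter a => some (some a) | .rightEnd => some none) fun a b h => by
      cases a <;> cases b <;> simp_all

/-- The stack with `l` pebbles whose positions are, from the bottom to the top,
`e 0, …, e (l - 1)`. -/
def stackOf (l : ℕ) (e : ℕ → ℕ) : List ℕ := (List.range l).reverse.map e

theorem stackOf_succ (l : ℕ) (e : ℕ → ℕ) : stackOf (l + 1) e = e l :: stackOf l e := by
  simp [stackOf, List.range_succ]

theorem length_stackOf (l : ℕ) (e : ℕ → ℕ) : (stackOf l e).length = l := by simp [stackOf]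

theorem stackOf_mark {B : Type*} {l v : ℕ} (h : l ≤ v) (W : MarkedWord B ℕ) (p : Fin W.length) :
    stackOf l (W.mark v p).pos = stackOf l W.pos :=
  List.map_congr_left fun _ hi => W.pos_mark_of_ne
    ((List.mem_range.1 (List.mem_reverse.1 hi)).trans_le h).ne p

theorem finiteIndex_tapeView [Finite α] (l : ℕ) :
    FiniteIndex fun W : MarkedWord (TapeSymbol α) ℕ =>
      tapeView W.label (W.pos l :: stackOf l W.pos) := by
  simp only [← stackOf_succ]
  refine ((FiniteIndex.listMap (fun v => .label v) (List.range (l + 1)).reverse).map₂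
    (.listMap (fun u => .listMap (fun v => .compare_pos u v) (List.range (l + 1)).reverse)
      (List.range (l + 1)).reverse) PebbleView.mk).congr fun W => ?_
  simp [tapeView, stackOf, Function.comp_def]

theorem finiteIndex_move_apply {B : Type*} (m : Move) (u v : ℕ) :
    FiniteIndex fun W : MarkedWord B ℕ => m.apply (W.length - 1) (W.pos u) = some (W.pos v) := by
  cases m with
  | left =>
    refine (FiniteIndex.pos_add_one_eq_pos v u).congr fun W => propext ?_
    cases W.pos u <;> simp [Move.apply, eq_comm]
  | stay => simpa only [Move.apply, Option.some_inj] using FiniteIndex.pos_eq_pos u v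
  | right =>
    refine (FiniteIndex.pos_add_one_eq_pos u v).congr fun W => propext ?_
    have := W.pos_lt v
    simp only [Move.apply, ite_eq_iff, Option.some_inj, reduceCtorEq, and_false, or_false]
    omega

namespace PebbleAutomaton

variable (A : PebbleAutomaton Q α) (k l : ℕ) [Finite α] [Finite Q]

theorem finiteIndex_calls
    (h : l < k → ∀ ρ q, FiniteIndex fun W : MarkedWord (TapeSymbol α) ℕ =>
      A.Outcome k (W.length - 1) W.label (stackOf (l + 1) W.pos) ρ q (W.pos (l + 1)))
    (ρ : Option Q) (q : Q) :
    FiniteIndex fun W : MarkedWord (TapeSymbol α) ℕ =>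
      A.Calls k (W.length - 1) W.label (stackOf l W.pos) q (W.pos l) ρ := by
  simp only [Calls, length_stackOf]
  by_cases hl : l < k
  · refine .exists_finite fun q' =>
      ((finiteIndex_tapeView l).map fun V => A.next q V q' .push).and ?_
    refine (((FiniteIndex.pos_eq_zero (l + 1)).and (h hl ρ q')).exists_position (l + 1)).congr
      fun W => propext ?_
    have hW := Nat.zero_lt_of_lt (W.pos_lt l)
    simp only [MarkedWord.pos_mark_self, stackOf_mark le_rfl, stackOf_succ, hl, true_and,
      MarkedWord.length_mark, MarkedWord.label_mark]
    exact ⟨fun ⟨_, hp, h⟩ => hp ▸ h, fun h => ⟨⟨0, hW⟩, rfl, h⟩⟩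
  · simpa only [hl, false_and, and_false, exists_false] using .const False

theorem finiteIndex_outcome_of_calls
    (hcalls : ∀ ρ q, FiniteIndex fun W : MarkedWord (TapeSymbol α) ℕ =>
      A.Calls k (W.length - 1) W.label (stackOf l W.pos) q (W.pos l) ρ)
    (ρ : Option Q) (q : Q) :
    FiniteIndex fun W : MarkedWord (TapeSymbol α) ℕ =>
      A.Outcome k (W.length - 1) W.label (stackOf l W.pos) ρ q (W.pos l) := by
  have hexits (q : Q) : FiniteIndex fun W : MarkedWord (TapeSymbol α) ℕ =>
      A.Exits k (W.length - 1) W.label (stackOf l W.pos) ρ q (W.pos l) := by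
    cases ρ with
    | none => exact ((finiteIndex_tapeView l).map (A.halts q)).or (hcalls none q)
    | some q' => exact (finiteIndex_tapeView l).map fun V => A.next q V q' .pop
  have hadvances (q q' : Q) : FiniteIndex fun W : MarkedWord (TapeSymbol α) ℕ =>
      A.Advances k (W.length - 1) W.label (stackOf l W.pos) q (W.pos l) q' (W.pos (l + 1)) :=
    (FiniteIndex.exists_finite fun m =>
      ((finiteIndex_tapeView l).map fun V => A.next q V q' (.move m)).and
        (finiteIndex_move_apply m l (l + 1))).or
      ((FiniteIndex.pos_eq_pos l (l + 1)).and (hcalls (some q') q))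
  refine (FiniteIndex.leastFixedPoint hexits hadvances (u := l) (v := l + 1) (by omega) q).congr
    fun W => propext ?_
  have hl (p : Fin W.length) (p' : Fin (W.mark l p).length) :
      ((W.mark l p).mark (l + 1) p').pos l = p := by
    rw [MarkedWord.pos_mark_of_ne _ (by omega), MarkedWord.pos_mark_self]
  simp only [MarkedWord.pos_mark_self, hl, stackOf_mark le_rfl, stackOf_mark (Nat.le_succ l),
    MarkedWord.label_mark]
  exact (outcome_iff_forall (W.pos_lt l)).symm

theorem finiteIndex_outcome (ρ : Option Q) (q : Q) :
    FiniteIndex fun W : MarkedWord (TapeSymbol α) ℕ =>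
      A.Outcome k (W.length - 1) W.label (stackOf l W.pos) ρ q (W.pos l) := by
  induction h : k - l generalizing l ρ q with
  | zero =>
    exact finiteIndex_outcome_of_calls A k l
      (finiteIndex_calls A k l fun hl => absurd hl (by omega)) ρ q
  | succ d ih =>
    exact finiteIndex_outcome_of_calls A k l
      (finiteIndex_calls A k l fun _ ρ q => ih (l + 1) ρ q (by omega)) ρ q

end PebbleAutomaton

/-- The tape of `w` with all variables on the left end marker. -/
def tapeWord (ι : Type*) (w : List α) : MarkedWord (TapeSymbol α) ι where
  length := w.length + 2
  label := tapeSymbol w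
  pos _ := 0
  pos_lt _ := by omega

/-- The tapes of the words that begin with `x`, cut after `x`. -/
def tapePrefix (ι : Type*) (x : List α) : MarkedPrefix (TapeSymbol α) ι where
  length := x.length + 1
  label := tapeSymbol x
  pos _ := some 0
  pos_lt := by simp

/-- The tape of `z` without the left end marker. -/
def tapeRest (ι : Type*) (z : List α) : MarkedWord (TapeSymbol α) ι where
  length := z.length + 1
  label i := tapeSymbol z (i + 1)
  pos _ := 0
  pos_lt _ := by omega

theorem tapeSymbol_append (x z : List α) :
    tapeSymbol (x ++ z) = glue (x.length + 1) (tapeSymbol x) fun i => tapeSymbol z (i + 1) := by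
  funext i
  rcases i with _ | i
  · simp [glue, tapeSymbol]
  · rcases lt_or_ge i x.length with h | h
    · simp [glue, tapeSymbol, h, List.getElem?_append_left]
    · simp [glue, tapeSymbol, h.not_gt, List.getElem?_append_right h, Nat.add_sub_add_right]

theorem tapeWord_append (ι : Type*) (x z : List α) :
    tapeWord ι (x ++ z) = (tapePrefix ι x).append (tapeRest ι z) := by
  refine MarkedWord.ext ?_ (tapeSymbol_append x z) rfl
  simp only [tapeWord, tapePrefix, tapeRest, MarkedPrefix.append, List.length_append]
  omega

theorem FiniteIndex.isRegular {ι : Type*} {Φ : MarkedWord (TapeSymbol α) ι → Prop}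
    (hΦ : FiniteIndex Φ) : Language.IsRegular {w : List α | Φ (tapeWord ι w)} := by
  let quotient (ρ : MarkedWord (TapeSymbol α) ι → Prop) : Language α := {z | ρ (tapeRest ι z)}
  refine .of_finite_range_leftQuotient ((hΦ.image quotient).subset ?_)
  rintro _ ⟨x, rfl⟩
  refine ⟨_, ⟨tapePrefix ι x, rfl⟩, Set.ext fun z => ?_⟩
  exact iff_of_eq (congrArg Φ (tapeWord_append ι x z).symm)

theorem PebbleAutomaton.isRegular_accepts [Finite α] [Finite Q] (A : PebbleAutomaton Q α)
    (k : ℕ) (q : Q) :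
    Language.IsRegular {w : List α | A.Accepts k (w.length + 1) (tapeSymbol w) q (0, [])} := by
  simp only [accepts_iff_outcome]
  exact (A.finiteIndex_outcome k 0 none q).isRegular

end PebbleAutomata

section Transducers

variable {Q σ α β : Type*}

theorem PebbleTransducer.Produces.unique {T : PebbleTransducer Q α β} {k : ℕ} {w : List α} {q : Q}
    {c : ℕ × List ℕ} {u v : List β} (hu : T.Produces k w q c u) (hv : T.Produces k w q c v) :
    u = v := by
  induction hu generalizing v with
  | halt hstep => cases hv <;> simp_all
  | act hstep hact _ ih =>
    cases hv with
    | halt hstep' => simp_all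
    | act hstep' hact' hrest' =>
      obtain ⟨rfl, rfl, rfl⟩ : _ ∧ _ ∧ _ := by simpa [hstep] using hstep'
      obtain rfl := Option.some_injective _ (hact.symm.trans hact')
      rw [ih hrest']

/-- The automaton that runs `T` and, on the output of `T`, the automaton `M`. -/
def PebbleTransducer.product (T : PebbleTransducer Q α β) (M : DFA β σ) :
    PebbleAutomaton (Q × σ) α where
  halts s V := ∃ u, T.step s.1 V = (u, none) ∧ M.evalFrom s.2 u ∈ M.accept
  next s V s' a := ∃ u, T.step s.1 V = (u, some (s'.1, a)) ∧ M.evalFrom s.2 u = s'.2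

theorem PebbleTransducer.accepts_product_iff {T : PebbleTransducer Q α β} {M : DFA β σ} {k : ℕ}
    {w : List α} {s : Q × σ} {c : ℕ × List ℕ} :
    (T.product M).Accepts k (w.length + 1) (tapeSymbol w) s c ↔
      ∃ v, T.Produces k w s.1 c v ∧ M.evalFrom s.2 v ∈ M.accept := by
  constructor
  · intro h
    induction h with
    | halt hhalt =>
      obtain ⟨u, hstep, hu⟩ := hhalt
      exact ⟨u, .halt hstep, hu⟩
    | act hnext hact _ ih =>
      obtain ⟨u, hstep, hu⟩ := hnext
      obtain ⟨v, hrest, hv⟩ := ih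
      exact ⟨u ++ v, .act hstep hact hrest, by rwa [DFA.evalFrom_of_append, hu]⟩
  · obtain ⟨q, d⟩ := s
    rintro ⟨v, h : T.Produces k w q c v, hv⟩
    induction h generalizing d with
    | halt hstep => exact .halt ⟨_, hstep, hv⟩
    | act hstep hact _ ih =>
      rw [DFA.evalFrom_of_append] at hv
      exact .act (q' := (_, _)) ⟨_, hstep, rfl⟩ hact (ih _ hv)

theorem IsPolyregular.isRegular_preimage [Finite α] {f : List α → List β} (hf : IsPolyregular f)
    {L : Language β} (hL : L.IsRegular) : Language.IsRegular {w | f w ∈ L} := by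
  obtain ⟨k, Q, _, T, hT⟩ := hf
  obtain ⟨σ, _, M, rfl⟩ := hL
  have hmem (w : List α) : f w ∈ M.accepts ↔
      ∃ v, T.Produces k w T.start (0, []) v ∧ M.evalFrom M.start v ∈ M.accept :=
    ⟨fun h => ⟨f w, hT w, h⟩, fun ⟨_, hv, h⟩ => (hT w).unique hv ▸ h⟩
  simpa only [hmem, PebbleTransducer.accepts_product_iff] using
    (T.product M).isRegular_accepts k (T.start, M.start)

/-- A two-way transducer as a pebble transducer that uses no pebbles. -/
def TwoWayTransducer.toPebbleTransducer (T : TwoWayTransducer Q α β) : PebbleTransducer Q α β where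
  start := T.start
  step q V := (T.step q (V.symbols.headD .leftEnd)).map id (Option.map (Prod.map id .move))

theorem TwoWayTransducer.Produces.toPebbleTransducer {T : TwoWayTransducer Q α β} {w : List α}
    {q : Q} {p : ℕ} {v : List β} (h : T.Produces w q p v) :
    T.toPebbleTransducer.Produces 0 w q (p, []) v := by
  induction h with
  | halt hstep =>
    exact .halt (by simp [TwoWayTransducer.toPebbleTransducer, pebbleView, hstep])
  | @move _ _ _ _ m _ _ hstep hmove _ ih =>
    exact .act (a := .move m) (by simp [TwoWayTransducer.toPebbleTransducer, pebbleView, hstep])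
      (by simp [PebbleAction.apply, hmove]) ih

theorem IsRegular.isPolyregular {f : List α → List β} (hf : IsRegular f) : IsPolyregular f := by
  obtain ⟨Q, hQ, T, hT⟩ := hf
  exact ⟨0, Q, hQ, T.toPebbleTransducer, fun w => (hT w).toPebbleTransducer⟩

end Transducers

section CopyFirstHalf

variable {α : Type*}

theorem isRegular_setOf_mem (b : α) : Language.IsRegular {v : List α | b ∈ v} := by
  let M : DFA α Prop := ⟨fun s a => s ∨ b = a, False, {s | s}⟩
  have hM (s : Prop) (v : List α) : M.evalFrom s v = (s ∨ b ∈ v) := by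
    induction v generalizing s with
    | nil => simp
    | cons a v ih => simp only [DFA.evalFrom_cons, ih, M, List.mem_cons, or_assoc]
  refine Language.isRegular_iff.2 ⟨Prop, inferInstance, M, Set.ext fun v => ?_⟩
  exact (iff_of_eq (hM False v)).trans (iff_of_eq (false_or _))

theorem mem_copyFirstHalf_iff {a b : α} (hab : a ≠ b) (m p : ℕ) :
    b ∈ copyFirstHalf (List.replicate m a ++ b :: List.replicate p a) ↔ m < p := by
  have hlength : (List.replicate m a ++ b :: List.replicate p a).length = m + (p + 1) := by simp
  rw [copyFirstHalf, hlength, List.take_append, List.length_replicate]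
  rcases h : (m + (p + 1)) / 2 - m with _ | j
  · simp only [List.take_zero, List.append_nil, List.take_replicate, List.mem_replicate, hab.symm,
      and_false, false_iff]
    omega
  · simp only [List.take_succ_cons, List.mem_append, List.mem_cons, true_or, or_true, true_iff]
    omega

theorem not_isRegular_setOf_mem_copyFirstHalf {a b : α} (hab : a ≠ b) :
    ¬ Language.IsRegular {w : List α | b ∈ copyFirstHalf w} := by
  intro h
  refine Set.infinite_range_of_injective ?_
    (h.finite_range_leftQuotient.subset (Set.range_comp_subset_range (List.replicate · a) _))
  intro m m' hm
  have hiff (p : ℕ) : m < p ↔ m' < p := by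
    rw [← mem_copyFirstHalf_iff hab, ← mem_copyFirstHalf_iff hab]
    exact Set.ext_iff.1 hm (b :: List.replicate p a)
  exact eq_of_forall_gt_iff hiff

theorem not_isPolyregular_copyFirstHalf [Finite α] [Nontrivial α] :
    ¬ IsPolyregular (copyFirstHalf (α := α)) := by
  obtain ⟨a, b, hab⟩ := exists_pair_ne α
  exact fun h =>
    not_isRegular_setOf_mem_copyFirstHalf hab (h.isRegular_preimage (isRegular_setOf_mem b))

end CopyFirstHalf

end Transduction

namespace BRASP

theorem flatten_ofFn_take {α : Type*} (w : List α) (m : ℕ) :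
    (List.ofFn fun i : Fin w.length => if (i : ℕ) < m then [w.get i] else []).flatten =
      w.take m := by
  induction w generalizing m with
  | nil => simp
  | cons a w ih =>
    cases m with
    | zero => simp
    | succ m => simpa [List.ofFn_succ] using ih m

/-- The program that keeps the first half of the input and replaces the rest by `d`. The length `n`
is not available, but sums are clipped to `n - 1`: the test `pos < pos + pos + 1 - pos` means
`i < min (2 * i + 1) (n - 1) - i`, which is equivalent to `2 * i + 1 < n`. -/
def firstHalfProgram {Δ : Type} (d : Δ) : Program Δ [.char, .nat] :=
  let pos : NatExp [.char, .nat] := .vec (.prev .last)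
  .define (.pointwise (.ite (.cmp () .lt pos (.sub (.add (.add pos pos) .one) pos))
    (.charVec .last ()) (.symbol d))) (.out .last)

theorem eval_firstHalfProgram {Δ : Type} (d : Δ) {n : ℕ} (input : Fin n → Δ) (i : Fin n) :
    (firstHalfProgram d).eval (initialEnv input) i = if (i : ℕ) < n / 2 then input i else d := by
  have htest (i : ℕ) (hi : i < n) :
      i < min (min (i + i) (n - 1) + min 1 (n - 1)) (n - 1) - i ↔ i < n / 2 := by omega
  change cond (decide _) _ _ = _
  rw [Bool.cond_decide]
  exact if_congr (htest i i.isLt) rfl rfl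

theorem computable_copyFirstHalf {α : Type*} [Finite α] :
    Computable (Transduction.copyFirstHalf (α := α)) := by
  have : Finite (Packed α 1) := List.finite_length_le α 1
  obtain ⟨N, ⟨e⟩⟩ := Finite.exists_equiv_fin (Packed α 1)
  let letter : α ↪ Packed α 1 := ⟨fun a => ⟨[a], le_rfl⟩, fun a b h => by simpa using h⟩
  refine ⟨1, Fin N, inferInstance, letter.trans e.toEmbedding, e.toEmbedding,
    firstHalfProgram (e ⟨[], zero_le⟩), fun w => ?_⟩
  refine ⟨fun i => if (i : ℕ) < w.length / 2 then letter (w.get i) else ⟨[], zero_le⟩,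
    funext fun i => ?_, ?_⟩
  · rw [eval_firstHalfProgram]
    exact (apply_ite e _ _ _).symm
  · simp only [apply_ite Subtype.val]
    exact flatten_ofFn_take w (w.length / 2)

end BRASP

/-- For every finite alphabet `α`, B-RASP[pos] with packed outputs computes copy-first-half, and
if `α` has at least two letters, copy-first-half is neither regular nor polyregular. -/
theorem mainTheorem7 {α : Type*} [Finite α] :
    BRASP.Computable (Transduction.copyFirstHalf (α := α)) ∧
      (Nontrivial α →
        ¬ Transduction.IsRegular (Transduction.copyFirstHalf (α := α)) ∧
          ¬ Transduction.IsPolyregular (Transduction.copyFirstHalf (α := α))) := by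
  exact ⟨BRASP.computable_copyFirstHalf, fun _ =>
    ⟨fun h => Transduction.not_isPolyregular_copyFirstHalf h.isPolyregular,
      Transduction.not_isPolyregular_copyFirstHalf⟩⟩
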